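/- Let $k$ be a field, and write $\otimes$ for $\otimes_k$. All algebras are associative and unital, and algebra morphisms are unital; identity maps are written $1$. A Hopf-Galois system over $k$ consists of four non-zero $k$-algebras $(A,B,Z,T)$ such that: (HG1) $A$ and $B$ are bialgebras. (HG2) $Z$ is an $A$-$B$-bicomodule algebra: there are algebra morphisms $\alpha : Z \to A \otimes Z$ and $\beta : Z \to Z \otimes B$ that make $Z$ a (coassociative, counital) left $A$-comodule and right $B$-comodule, with $(\alpha \otimes 1_B)\circ\beta = (1_A \otimes \beta)\circ\alpha$. (HG3) There are algebra morphisms $\gamma : A \to Z \otimes T$ and $\delta : B \to T \otimes Z$ with $$(\gamma \otimes 1_Z)\circ\alpha = (1_Z \otimes \delta)\circ\beta,\qquad (1_A \otimes \gamma)\circ\Delta_A = (\alpha \otimes 1_T)\circ\gamma,\qquad (\delta \otimes 1_B)\circ\Delta_B = (1_T \otimes \beta)\circ\delta .$$ (HG4) There is a linear map $S : T \to Z$ with $$m_Z\circ(1_Z \otimes S)\circ\gamma = u_Z\circ\varepsilon_A,\qquad m_Z\circ(S \otimes 1_Z)\circ\delta = u_Z\circ\varepsilon_B,$$ where $m_Z$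 and $u_Z$ are the multiplication and the unit of $Z$. For a bialgebra $A$ let $\mathrm{Comod}(A)$ be the monoidal category of all (possibly infinite-dimensional) right $A$-comodules, with the tensor product over $k$ and the coaction $v \otimes w \mapsto v_{(0)} \otimes w_{(0)} \otimes v_{(1)}w_{(1)}$. **Corollary 1.4.** If $(A,B,Z,T)$ is a Hopf-Galois system over $k$, then $\mathrm{Comod}(A)$ and $\mathrm{Comod}(B)$ are monoidally equivalent, that is, there is an equivalence of categories $\mathrm{Comod}(A) \to \mathrm{Comod}(B)$ that is a (strong) monoidal functor. -/

import Mathlib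

universe u

namespace RightComod

section Mul

open TensorProduct

variable {k : Type u} [Field k] {C D : Type u} [Ring C] [Algebra k C] [Ring D] [Algebra k D]
  {V V' W W' X : Type u} [AddCommGroup V] [Module k V] [AddCommGroup V'] [Module k V']
  [AddCommGroup W] [Module k W] [AddCommGroup W'] [Module k W'] [AddCommGroup X] [Module k X]

variable (k C V W) in
/-- The linear map `(V ⊗ C) ⊗ (W ⊗ C) → (V ⊗ W) ⊗ C`, `(v ⊗ c) ⊗ (w ⊗ d) ↦ (v ⊗ w) ⊗ c d`. -/
noncomputable def gather : (V ⊗[k] C) ⊗[k] (W ⊗[k] C) →ₗ[k] (V ⊗[k] W) ⊗[k] C :=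
  (LinearMap.mul' k C).lTensor (V ⊗[k] W) ∘ₗ
    (TensorProduct.tensorTensorTensorComm k V C W C).toLinearMap

@[simp] theorem gather_tmul (v : V) (c : C) (w : W) (d : C) :
    gather k C V W ((v ⊗ₜ c) ⊗ₜ (w ⊗ₜ d)) = (v ⊗ₜ w) ⊗ₜ (c * d) := by
  simp [gather]

theorem gather_map (f : V →ₗ[k] V') (g : W →ₗ[k] W') (h : C →ₐ[k] D) :
    gather k D V' W' ∘ₗ
        TensorProduct.map (TensorProduct.map f h.toLinearMap) (TensorProduct.map g h.toLinearMap) =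
      TensorProduct.map (TensorProduct.map f g) h.toLinearMap ∘ₗ gather k C V W := by
  ext v c w d
  simp

/-- The diagonal coaction `v ⊗ w ↦ v₀ ⊗ w₀ ⊗ v₁ w₁` on a tensor product. -/
noncomputable def diag (ρ : V →ₗ[k] V ⊗[k] C) (σ : W →ₗ[k] W ⊗[k] C) :
    V ⊗[k] W →ₗ[k] (V ⊗[k] W) ⊗[k] C :=
  gather k C V W ∘ₗ TensorProduct.map ρ σ

theorem diag_tmul (ρ : V →ₗ[k] V ⊗[k] C) (σ : W →ₗ[k] W ⊗[k] C) (v : V) (w : W) :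
    diag ρ σ (v ⊗ₜ w) = gather k C V W (ρ v ⊗ₜ σ w) := rfl

theorem diag_map (ρ : V →ₗ[k] V ⊗[k] C) (σ : W →ₗ[k] W ⊗[k] C)
    (ρ' : V' →ₗ[k] V' ⊗[k] C) (σ' : W' →ₗ[k] W' ⊗[k] C) (f : V →ₗ[k] V') (g : W →ₗ[k] W')
    (hf : ρ' ∘ₗ f = f.rTensor C ∘ₗ ρ) (hg : σ' ∘ₗ g = g.rTensor C ∘ₗ σ) :
    diag ρ' σ' ∘ₗ TensorProduct.map f g = (TensorProduct.map f g).rTensor C ∘ₗ diag ρ σ := by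
  have h := gather_map f g (AlgHom.id k C)
  simp only [AlgHom.toLinearMap_id] at h
  simp only [diag, LinearMap.comp_assoc, ← TensorProduct.map_comp, hf, hg]
  simp only [TensorProduct.map_comp, ← LinearMap.comp_assoc, LinearMap.rTensor, h]

theorem gather_assoc (x : V ⊗[k] C) (y : W ⊗[k] C) (z : X ⊗[k] C) :
    (TensorProduct.assoc k V W X).toLinearMap.rTensor C
        (gather k C (V ⊗[k] W) X (gather k C V W (x ⊗ₜ y) ⊗ₜ z)) =
      gather k C V (W ⊗[k] X) (x ⊗ₜ gather k C W X (y ⊗ₜ z)) := by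
  induction x with
  | zero => simp
  | add x x' h h' => simp only [add_tmul, map_add, h, h']
  | tmul v a =>
    induction y with
    | zero => simp
    | add x x' h h' => simp only [add_tmul, tmul_add, map_add, h, h']
    | tmul w b =>
      induction z with
      | zero => simp
      | add x x' h h' => simp only [tmul_add, map_add, h, h']
      | tmul x c => simp [mul_assoc]

theorem diag_assoc (ρ : V →ₗ[k] V ⊗[k] C) (σ : W →ₗ[k] W ⊗[k] C) (τ : X →ₗ[k] X ⊗[k] C) :
    diag ρ (diag σ τ) ∘ₗ (TensorProduct.assoc k V W X).toLinearMap =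
      (TensorProduct.assoc k V W X).toLinearMap.rTensor C ∘ₗ diag (diag ρ σ) τ := by
  refine TensorProduct.ext_threefold fun v w x => ?_
  simp only [LinearMap.comp_apply, LinearEquiv.coe_coe, assoc_tmul, diag_tmul]
  exact (gather_assoc _ _ _).symm

variable (k C) in
/-- The trivial coaction `1 ↦ 1 ⊗ 1` on the base field. -/
noncomputable def triv : k →ₗ[k] k ⊗[k] C := (TensorProduct.mk k k C).flip 1

theorem lid_diag (ρ : V →ₗ[k] V ⊗[k] C) :
    ρ ∘ₗ (TensorProduct.lid k V).toLinearMap =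
      (TensorProduct.lid k V).toLinearMap.rTensor C ∘ₗ diag (triv k C) ρ := by
  ext v
  have h : ∀ x : V ⊗[k] C, (TensorProduct.lid k V).toLinearMap.rTensor C
      (gather k C k V (((1 : k) ⊗ₜ (1 : C)) ⊗ₜ x)) = x := by
    intro x
    induction x with
    | zero => simp
    | add x x' h h' => simp only [tmul_add, map_add, h, h']
    | tmul v a => simp
  simpa [triv, diag_tmul] using (h (ρ v)).symm

theorem rid_diag (ρ : V →ₗ[k] V ⊗[k] C) :
    ρ ∘ₗ (TensorProduct.rid k V).toLinearMap =
      (TensorProduct.rid k V).toLinearMap.rTensor C ∘ₗ diag ρ (triv k C) := by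
  ext v
  have h : ∀ x : V ⊗[k] C, (TensorProduct.rid k V).toLinearMap.rTensor C
      (gather k C V k (x ⊗ₜ ((1 : k) ⊗ₜ (1 : C)))) = x := by
    intro x
    induction x with
    | zero => simp
    | add x x' h h' => simp only [add_tmul, map_add, h, h']
    | tmul v a => simp
  simpa [triv, diag_tmul] using (h (ρ v)).symm

end Mul

section Laws

open TensorProduct

variable {k : Type u} [Field k] {A : Type u} [Ring A] [Bialgebra k A]
  {V W : Type u} [AddCommGroup V] [Module k V] [AddCommGroup W] [Module k W]

theorem diag_coassoc (ρ : V →ₗ[k] V ⊗[k] A) (σ : W →ₗ[k] W ⊗[k] A)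
    (hρ : (TensorProduct.assoc k V A A).toLinearMap ∘ₗ ρ.rTensor A ∘ₗ ρ =
      (Coalgebra.comul (R := k) (A := A)).lTensor V ∘ₗ ρ)
    (hσ : (TensorProduct.assoc k W A A).toLinearMap ∘ₗ σ.rTensor A ∘ₗ σ =
      (Coalgebra.comul (R := k) (A := A)).lTensor W ∘ₗ σ) :
    (TensorProduct.assoc k (V ⊗[k] W) A A).toLinearMap ∘ₗ (diag ρ σ).rTensor A ∘ₗ diag ρ σ =
      (Coalgebra.comul (R := k) (A := A)).lTensor (V ⊗[k] W) ∘ₗ diag ρ σ := by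
  have key : ∀ (x : V ⊗[k] A) (y : W ⊗[k] A) (a b : A),
      TensorProduct.assoc k (V ⊗[k] W) A A (gather k A V W (x ⊗ₜ y) ⊗ₜ (a * b)) =
        gather k (A ⊗[k] A) V W
          (TensorProduct.assoc k V A A (x ⊗ₜ a) ⊗ₜ TensorProduct.assoc k W A A (y ⊗ₜ b)) := by
    intro x y a b
    induction x with
    | zero => simp
    | add x x' h h' => simp only [add_tmul, map_add, h, h']
    | tmul v c =>
      induction y with
      | zero => simp
      | add x x' h h' => simp only [add_tmul, tmul_add, map_add, h, h']
      | tmul w d => simp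
  have left : ((TensorProduct.assoc k (V ⊗[k] W) A A).toLinearMap ∘ₗ (diag ρ σ).rTensor A) ∘ₗ
        gather k A V W =
      gather k (A ⊗[k] A) V W ∘ₗ
        TensorProduct.map ((TensorProduct.assoc k V A A).toLinearMap ∘ₗ ρ.rTensor A)
          ((TensorProduct.assoc k W A A).toLinearMap ∘ₗ σ.rTensor A) := by
    ext v a w b
    simpa [diag_tmul] using key (ρ v) (σ w) a b
  have right := gather_map (LinearMap.id : V →ₗ[k] V) (LinearMap.id : W →ₗ[k] W)
    (Bialgebra.comulAlgHom k A)
  have e : (Bialgebra.comulAlgHom k A).toLinearMap = Coalgebra.comul (R := k) (A := A) := rfl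
  rw [e, TensorProduct.map_id] at right
  calc
    _ = (((TensorProduct.assoc k (V ⊗[k] W) A A).toLinearMap ∘ₗ (diag ρ σ).rTensor A) ∘ₗ
        gather k A V W) ∘ₗ TensorProduct.map ρ σ := rfl
    _ = (Coalgebra.comul (R := k) (A := A)).lTensor (V ⊗[k] W) ∘ₗ
        gather k A V W ∘ₗ TensorProduct.map ρ σ := by
      rw [left, LinearMap.comp_assoc, ← TensorProduct.map_comp, LinearMap.comp_assoc,
        LinearMap.comp_assoc, hρ, hσ, TensorProduct.map_comp]
      simp only [← LinearMap.comp_assoc, LinearMap.lTensor]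
      rw [right]

theorem diag_counit (ρ : V →ₗ[k] V ⊗[k] A) (σ : W →ₗ[k] W ⊗[k] A)
    (hρ : (Coalgebra.counit (R := k) (A := A)).lTensor V ∘ₗ ρ = (TensorProduct.mk k V k).flip 1)
    (hσ : (Coalgebra.counit (R := k) (A := A)).lTensor W ∘ₗ σ = (TensorProduct.mk k W k).flip 1) :
    (Coalgebra.counit (R := k) (A := A)).lTensor (V ⊗[k] W) ∘ₗ diag ρ σ =
      (TensorProduct.mk k (V ⊗[k] W) k).flip 1 := by
  have right := gather_map (LinearMap.id : V →ₗ[k] V) (LinearMap.id : W →ₗ[k] W)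
    (Bialgebra.counitAlgHom k A)
  have e : (Bialgebra.counitAlgHom k A).toLinearMap = Coalgebra.counit (R := k) (A := A) := rfl
  rw [e, TensorProduct.map_id] at right
  simp only [LinearMap.lTensor] at hρ hσ ⊢
  rw [diag, ← LinearMap.comp_assoc, ← right, LinearMap.comp_assoc, ← TensorProduct.map_comp,
    hρ, hσ]
  ext v w
  simp

theorem triv_coassoc :
    (TensorProduct.assoc k k A A).toLinearMap ∘ₗ (triv k A).rTensor A ∘ₗ triv k A =
      (Coalgebra.comul (R := k) (A := A)).lTensor k ∘ₗ triv k A := by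
  ext
  simp [triv, Algebra.TensorProduct.one_def]

theorem triv_counit :
    (Coalgebra.counit (R := k) (A := A)).lTensor k ∘ₗ triv k A =
      (TensorProduct.mk k k k).flip 1 := by
  ext
  simp [triv]

end Laws

end RightComod

section Category

open TensorProduct CategoryTheory

/-- Right comodules over the bialgebra `A` over the field `k`: vector spaces `V`, of any
dimension, with a coassociative and counital linear map `V → V ⊗ A`. -/
structure Comod (k : Type u) [Field k] (A : Type u) [Ring A] [Bialgebra k A] where
  carrier : Type u
  [addCommGroup : AddCommGroup carrier]
  [module : Module k carrier]
  coact : carrier →ₗ[k] carrier ⊗[k] A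
  coassoc : (TensorProduct.assoc k carrier A A).toLinearMap ∘ₗ coact.rTensor A ∘ₗ coact =
    (Coalgebra.comul (R := k) (A := A)).lTensor carrier ∘ₗ coact
  counit : (Coalgebra.counit (R := k) (A := A)).lTensor carrier ∘ₗ coact =
    (TensorProduct.mk k carrier k).flip 1

attribute [instance] Comod.addCommGroup Comod.module

namespace Comod

variable {k : Type u} [Field k] {A : Type u} [Ring A] [Bialgebra k A]

/-- Morphisms of right comodules: colinear maps. -/
@[ext] structure Hom (V W : Comod k A) where
  lin : V.carrier →ₗ[k] W.carrier
  colinear : W.coact ∘ₗ lin = lin.rTensor A ∘ₗ V.coact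

instance : Category (Comod k A) where
  Hom V W := Hom V W
  id V := ⟨LinearMap.id, by simp⟩
  comp f g := ⟨g.lin ∘ₗ f.lin, by
    rw [← LinearMap.comp_assoc, g.colinear, LinearMap.comp_assoc, f.colinear,
      LinearMap.rTensor_comp, LinearMap.comp_assoc]⟩

@[ext] theorem hom_ext {V W : Comod k A} {f g : V ⟶ W} (h : f.lin = g.lin) : f = g :=
  Hom.ext h

@[simp] theorem id_lin (V : Comod k A) : Hom.lin (𝟙 V) = LinearMap.id := rfl

@[simp] theorem comp_lin {V W X : Comod k A} (f : V ⟶ W) (g : W ⟶ X) :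
    (f ≫ g).lin = g.lin ∘ₗ f.lin := rfl

/-- A colinear bijection is an isomorphism of comodules. -/
def mkIso {V W : Comod k A} (e : V.carrier ≃ₗ[k] W.carrier)
    (h : W.coact ∘ₗ e.toLinearMap = e.toLinearMap.rTensor A ∘ₗ V.coact) : V ≅ W where
  hom := ⟨e.toLinearMap, h⟩
  inv := ⟨e.symm.toLinearMap, by
    have h2 : e.symm.toLinearMap.rTensor A ∘ₗ (W.coact ∘ₗ e.toLinearMap) ∘ₗ
        e.symm.toLinearMap = e.symm.toLinearMap.rTensor A ∘ₗ W.coact := by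
      ext; simp
    rw [← h2, h, LinearMap.comp_assoc, ← LinearMap.comp_assoc, ← LinearMap.rTensor_comp]
    simp⟩
  hom_inv_id := by ext; simp
  inv_hom_id := by ext; simp

/-- The tensor product of comodules, with the diagonal coaction. -/
noncomputable abbrev tensor (V W : Comod k A) : Comod k A where
  carrier := V.carrier ⊗[k] W.carrier
  coact := RightComod.diag V.coact W.coact
  coassoc := RightComod.diag_coassoc _ _ V.coassoc W.coassoc
  counit := RightComod.diag_counit _ _ V.counit W.counit

variable (k A) in
/-- The base field with the trivial coaction. -/
noncomputable abbrev unit : Comod k A where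
  carrier := k
  coact := RightComod.triv k A
  coassoc := RightComod.triv_coassoc
  counit := RightComod.triv_counit

noncomputable abbrev tensorMap {V V' W W' : Comod k A} (f : V ⟶ V') (g : W ⟶ W') :
    tensor V W ⟶ tensor V' W' :=
  ⟨TensorProduct.map f.lin g.lin, RightComod.diag_map _ _ _ _ _ _ f.colinear g.colinear⟩

noncomputable instance : MonoidalCategoryStruct (Comod k A) where
  tensorObj := tensor
  whiskerLeft V _ _ g := tensorMap (𝟙 V) g
  whiskerRight f W := tensorMap f (𝟙 W)
  tensorHom f g := tensorMap f g
  tensorUnit := unit k A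
  associator V W X := mkIso (TensorProduct.assoc k V.carrier W.carrier X.carrier)
    (RightComod.diag_assoc _ _ _)
  leftUnitor V := mkIso (TensorProduct.lid k V.carrier) (RightComod.lid_diag _)
  rightUnitor V := mkIso (TensorProduct.rid k V.carrier) (RightComod.rid_diag _)

/-- The monoidal category of right `A`-comodules: the tensor product over `k` with the diagonal
coaction, and the associativity and unit isomorphisms of vector spaces. -/
noncomputable instance : MonoidalCategory (Comod k A) := MonoidalCategory.ofTensorHom
  (id_tensorHom_id := fun V W => Comod.hom_ext (TensorProduct.ext rfl))
  (tensorHom_comp_tensorHom := fun _ _ _ _ => Comod.hom_ext (TensorProduct.ext rfl))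
  (associator_naturality := fun _ _ _ =>
    Comod.hom_ext (TensorProduct.ext_threefold fun _ _ _ => rfl))
  (leftUnitor_naturality := fun f =>
    Comod.hom_ext (TensorProduct.ext (LinearMap.ext_ring (LinearMap.ext fun v => by
      change (1 : k) • f.lin v = f.lin ((1 : k) • v)
      simp))))
  (rightUnitor_naturality := fun f =>
    Comod.hom_ext (TensorProduct.ext (LinearMap.ext fun v => LinearMap.ext_ring (by
      change (1 : k) • f.lin v = f.lin ((1 : k) • v)
      simp))))
  (pentagon := fun _ _ _ _ => Comod.hom_ext (TensorProduct.ext_fourfold fun _ _ _ _ => rfl))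
  (triangle := fun _ _ => Comod.hom_ext (TensorProduct.ext_threefold fun v c w =>
    TensorProduct.tmul_smul c v w))

end Comod

/-- Two monoidal categories are monoidally equivalent if there is an equivalence between them
whose underlying functor is (strong) monoidal. -/
def MonoidallyEquivalent (C D : Type*) [Category C] [MonoidalCategory C]
    [Category D] [MonoidalCategory D] : Prop :=
  ∃ e : C ≌ D, Nonempty e.functor.Monoidal

end Category

section System

open TensorProduct

/-- A Hopf-Galois system `(A, B, Z, T)` over the field `k`: `A` and `B` are bialgebras, `Z` and
`T` are algebras, none of them zero. -/
structure HopfGaloisSystem (k : Type u) [Field k] (A B Z T : Type u)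
    [Ring A] [Bialgebra k A] [Ring B] [Bialgebra k B] [Ring Z] [Algebra k Z]
    [Ring T] [Algebra k T] where
  nontrivial_A : Nontrivial A
  nontrivial_B : Nontrivial B
  nontrivial_Z : Nontrivial Z
  nontrivial_T : Nontrivial T
  /-- The left coaction of `A` on the algebra `Z`. -/
  α : Z →ₐ[k] A ⊗[k] Z
  /-- The right coaction of `B` on the algebra `Z`. -/
  β : Z →ₐ[k] Z ⊗[k] B
  α_coassoc : (TensorProduct.assoc k A A Z).toLinearMap ∘ₗ
      (Coalgebra.comul (R := k) (A := A)).rTensor Z ∘ₗ α.toLinearMap =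
    α.toLinearMap.lTensor A ∘ₗ α.toLinearMap
  α_counit : (Coalgebra.counit (R := k) (A := A)).rTensor Z ∘ₗ α.toLinearMap =
    TensorProduct.mk k k Z 1
  β_coassoc : (TensorProduct.assoc k Z B B).toLinearMap ∘ₗ
      β.toLinearMap.rTensor B ∘ₗ β.toLinearMap =
    (Coalgebra.comul (R := k) (A := B)).lTensor Z ∘ₗ β.toLinearMap
  β_counit : (Coalgebra.counit (R := k) (A := B)).lTensor Z ∘ₗ β.toLinearMap =
    (TensorProduct.mk k Z k).flip 1
  /-- The two coactions on `Z` commute. -/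
  bicomodule : (TensorProduct.assoc k A Z B).toLinearMap ∘ₗ
      α.toLinearMap.rTensor B ∘ₗ β.toLinearMap =
    β.toLinearMap.lTensor A ∘ₗ α.toLinearMap
  γ : A →ₐ[k] Z ⊗[k] T
  δ : B →ₐ[k] T ⊗[k] Z
  /-- `(γ ⊗ 1) ∘ α = (1 ⊗ δ) ∘ β` as maps `Z → Z ⊗ T ⊗ Z`. -/
  γ_α : (TensorProduct.assoc k Z T Z).toLinearMap ∘ₗ
      γ.toLinearMap.rTensor Z ∘ₗ α.toLinearMap =
    δ.toLinearMap.lTensor Z ∘ₗ β.toLinearMap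
  /-- `(1 ⊗ γ) ∘ Δ = (α ⊗ 1) ∘ γ` as maps `A → A ⊗ Z ⊗ T`. -/
  γ_comul : γ.toLinearMap.lTensor A ∘ₗ Coalgebra.comul (R := k) (A := A) =
    (TensorProduct.assoc k A Z T).toLinearMap ∘ₗ α.toLinearMap.rTensor T ∘ₗ γ.toLinearMap
  /-- `(δ ⊗ 1) ∘ Δ = (1 ⊗ β) ∘ δ` as maps `B → T ⊗ Z ⊗ B`. -/
  δ_comul : (TensorProduct.assoc k T Z B).toLinearMap ∘ₗ
      δ.toLinearMap.rTensor B ∘ₗ Coalgebra.comul (R := k) (A := B) =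
    β.toLinearMap.lTensor T ∘ₗ δ.toLinearMap
  S : T →ₗ[k] Z
  /-- `m ∘ (1 ⊗ S) ∘ γ = u ∘ ε` as maps `A → Z`. -/
  S_γ : LinearMap.mul' k Z ∘ₗ S.lTensor Z ∘ₗ γ.toLinearMap =
    Algebra.linearMap k Z ∘ₗ Coalgebra.counit (R := k) (A := A)
  /-- `m ∘ (S ⊗ 1) ∘ δ = u ∘ ε` as maps `B → Z`. -/
  S_δ : LinearMap.mul' k Z ∘ₗ S.rTensor Z ∘ₗ δ.toLinearMap =
    Algebra.linearMap k Z ∘ₗ Coalgebra.counit (R := k) (A := B)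

end System

/-! ### Sweedler calculus: applying maps to the last leg of a tensor product -/

section Expand

open TensorProduct

variable {k : Type u} [Field k] {C D E P Q R V W : Type u}
  [AddCommMonoid C] [Module k C] [AddCommMonoid D] [Module k D] [AddCommMonoid E] [Module k E]
  [AddCommMonoid P] [Module k P] [AddCommMonoid Q] [Module k Q] [AddCommMonoid R] [Module k R]
  [AddCommMonoid V] [Module k V] [AddCommMonoid W] [Module k W]

namespace TensorProduct

/-! The equivalence is `V ↦ V □ Z`, cotensoring with the `A`-`B`-bicomodule algebra `Z`. The algebra
`T` and the map `S` enter only through the translation maps `j = (1 ⊗ S)γ : A → Z ⊗ Z` and `i = (S ⊗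
1)δ : B → Z ⊗ Z`. The axioms give (α ⊗ 1)j = (1 ⊗ j)Δ, (1 ⊗ β)i = (i ⊗ 1)Δ, (j ⊗ 1)α = (1 ⊗ i)β, and
m j = ε, m i = ε.

The inverse functor needs no second bicomodule. It sends `W` to the space of those w ⊗ z in W ⊗ Z
(sums understood) with w₀ ⊗ i(w₁)z = w ⊗ z ⊗ 1. The `A`-coaction there is forced by requiring that
`j`, applied to its `A`-leg, give w₀ ⊗ i(w₁) ⊗ z; it exists because `j` has a retraction and its
image is cut out by a descent equation (`expand_j_unj`). The natural isomorphisms are v ↦ v₀ ⊗ j(v₁)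
and w ↦ w₀ ⊗ i(w₁). Both are inverted by multiplying the two `Z`-legs and applying a functional `φ`
with φ(1) = 1.

Since α and β are multiplicative, multiplication in `Z` gives a colinear map (V □ Z) ⊗ (W □ Z) → (V
⊗ W) □ Z. It is bijective because it becomes so after tensoring with the nonzero space `Z`: there
multiplication gives (V □ Z) ⊗ Z ≅ V ⊗ Z, with inverse v ⊗ z ↦ v₀ ⊗ j(v₁)z (`descentEquiv`).
Coherence is then inherited from associativity and unitality of `Z`. -/

variable (V) in
/-- A linear map `C → D ⊗ E` applied to the last factor of `V ⊗ C`, with values in the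
left-bracketed tensor product. -/
noncomputable def expand (h : C →ₗ[k] D ⊗[k] E) : V ⊗[k] C →ₗ[k] (V ⊗[k] D) ⊗[k] E :=
  (TensorProduct.assoc k V D E).symm.toLinearMap ∘ₗ h.lTensor V

theorem expand_tmul (h : C →ₗ[k] D ⊗[k] E) (v : V) (c : C) :
    expand V h (v ⊗ₜ c) = (TensorProduct.assoc k V D E).symm (v ⊗ₜ h c) := rfl

/-- Naturality of `expand` in the first factor. -/
theorem expand_rTensor (h : C →ₗ[k] D ⊗[k] E) (f : V →ₗ[k] W) (x : V ⊗[k] C) :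
    expand W h (f.rTensor C x) = (f.rTensor D).rTensor E (expand V h x) := by
  induction x with
  | zero => simp
  | add x y hx hy => simp only [map_add, hx, hy]
  | tmul v c =>
    rw [LinearMap.rTensor_tmul, expand_tmul, expand_tmul]
    generalize h c = t
    induction t with
    | zero => simp
    | add x y hx hy => simp only [tmul_add, map_add, hx, hy]
    | tmul d e => simp

/-- Transports an identity of coassociativity type from `C` to the last leg of `V ⊗ C`.
Coassociativity of β, commutation of α and β, and the compatibilities of `γ` and `δ` are all used in
this form. -/
theorem expand_rTensor_expand {h : C →ₗ[k] D ⊗[k] E} {g : D →ₗ[k] P ⊗[k] Q}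
    {h' : C →ₗ[k] P ⊗[k] R} {g' : R →ₗ[k] Q ⊗[k] E}
    (H : (TensorProduct.assoc k P Q E).toLinearMap ∘ₗ g.rTensor E ∘ₗ h = g'.lTensor P ∘ₗ h')
    (x : V ⊗[k] C) :
    (expand V g).rTensor E (expand V h x) = expand (V ⊗[k] P) g' (expand V h' x) := by
  let Φ : V ⊗[k] (P ⊗[k] (Q ⊗[k] E)) →ₗ[k] ((V ⊗[k] P) ⊗[k] Q) ⊗[k] E :=
    (TensorProduct.assoc k (V ⊗[k] P) Q E).symm.toLinearMap ∘ₗ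
      (TensorProduct.assoc k V P (Q ⊗[k] E)).symm.toLinearMap
  induction x with
  | zero => simp
  | add x y hx hy => simp only [map_add, hx, hy]
  | tmul v c =>
    have left : ∀ t : D ⊗[k] E, (expand V g).rTensor E ((TensorProduct.assoc k V D E).symm
        (v ⊗ₜ t)) = Φ (v ⊗ₜ TensorProduct.assoc k P Q E (g.rTensor E t)) := by
      intro t
      induction t with
      | zero => simp
      | add x y hx hy => simp only [tmul_add, map_add, hx, hy]
      | tmul d e =>
        simp only [assoc_symm_tmul, LinearMap.rTensor_tmul, expand_tmul]
        generalize g d = s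
        induction s with
        | zero => simp
        | add x y hx hy => simp only [tmul_add, add_tmul, map_add, hx, hy]
        | tmul p q => simp [Φ]
    have right : ∀ s : P ⊗[k] R, expand (V ⊗[k] P) g' ((TensorProduct.assoc k V P R).symm
        (v ⊗ₜ s)) = Φ (v ⊗ₜ g'.lTensor P s) := by
      intro s
      induction s with
      | zero => simp
      | add x y hx hy => simp only [tmul_add, map_add, hx, hy]
      | tmul p r => simp [Φ, expand_tmul]
    rw [expand_tmul, expand_tmul, left, right]
    exact congrArg (fun s => Φ (v ⊗ₜ s)) (LinearMap.congr_fun H c)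

variable (V) in
/-- A functional applied to the last factor of `V ⊗ C`. -/
noncomputable def contract (e : C →ₗ[k] k) : V ⊗[k] C →ₗ[k] V :=
  (TensorProduct.rid k V).toLinearMap ∘ₗ e.lTensor V

@[simp] theorem contract_tmul (e : C →ₗ[k] k) (v : V) (c : C) :
    contract V e (v ⊗ₜ c) = e c • v := by
  simp [contract]

theorem contract_rTensor (e : C →ₗ[k] k) (f : V →ₗ[k] W) (x : V ⊗[k] C) :
    contract W e (f.rTensor C x) = f (contract V e x) := by
  induction x with
  | zero => simp
  | add x y hx hy => simp only [map_add, hx, hy]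
  | tmul v c => simp

theorem contract_expand {e : E →ₗ[k] k} {h : C →ₗ[k] C ⊗[k] E}
    (H : e.lTensor C ∘ₗ h = (TensorProduct.mk k C k).flip 1) (x : V ⊗[k] C) :
    contract (V ⊗[k] C) e (expand V h x) = x := by
  induction x with
  | zero => simp
  | add x y hx hy => simp only [map_add, hx, hy]
  | tmul v c =>
    have key : ∀ t : C ⊗[k] E, contract (V ⊗[k] C) e ((TensorProduct.assoc k V C E).symm
        (v ⊗ₜ t)) = v ⊗ₜ TensorProduct.rid k C (e.lTensor C t) := by
      intro t
      induction t with
      | zero => simp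
      | add x y hx hy => simp only [tmul_add, map_add, hx, hy]
      | tmul d e => simp
    rw [expand_tmul, key]
    have := LinearMap.congr_fun H c
    simp only [LinearMap.comp_apply] at this
    simp [this]

theorem contract_rTensor_expand {e : D →ₗ[k] k} {h : C →ₗ[k] D ⊗[k] C}
    (H : e.rTensor C ∘ₗ h = TensorProduct.mk k k C 1) (x : V ⊗[k] C) :
    (contract V e).rTensor C (expand V h x) = x := by
  induction x with
  | zero => simp
  | add x y hx hy => simp only [map_add, hx, hy]
  | tmul v c =>
    have key : ∀ t : D ⊗[k] C, (contract V e).rTensor C ((TensorProduct.assoc k V D C).symm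
        (v ⊗ₜ t)) = v ⊗ₜ TensorProduct.lid k C (e.rTensor C t) := by
      intro t
      induction t with
      | zero => simp
      | add x y hx hy => simp only [tmul_add, map_add, hx, hy]
      | tmul d e => simp [smul_tmul']
    rw [expand_tmul, key]
    have := LinearMap.congr_fun H c
    simp only [LinearMap.comp_apply] at this
    simp [this]

end TensorProduct

theorem LinearMap.rTensor_rTensor_congr {f : V →ₗ[k] W} {g : W →ₗ[k] P} {f' : V →ₗ[k] Q}
    {g' : Q →ₗ[k] P} (H : ∀ v, g (f v) = g' (f' v)) (x : V ⊗[k] C) :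
    g.rTensor C (f.rTensor C x) = g'.rTensor C (f'.rTensor C x) := by
  rw [← LinearMap.rTensor_comp_apply, ← LinearMap.rTensor_comp_apply]
  congr 2
  exact LinearMap.ext H

section Algebra

variable {Z : Type u} [Ring Z] [Algebra k Z]

namespace TensorProduct

variable (k V Z) in
/-- Multiplication of the last two factors of `V ⊗ Z ⊗ Z`. -/
noncomputable def mulLast : (V ⊗[k] Z) ⊗[k] Z →ₗ[k] V ⊗[k] Z :=
  (LinearMap.mul' k Z).lTensor V ∘ₗ (TensorProduct.assoc k V Z Z).toLinearMap

@[simp] theorem mulLast_tmul (v : V) (x y : Z) :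
    mulLast k V Z ((v ⊗ₜ x) ⊗ₜ y) = v ⊗ₜ (x * y) := by
  simp [mulLast]

theorem mulLast_rTensor (f : V →ₗ[k] W) (x : (V ⊗[k] Z) ⊗[k] Z) :
    mulLast k W Z ((f.rTensor Z).rTensor Z x) = f.rTensor Z (mulLast k V Z x) := by
  have : mulLast k W Z ∘ₗ (f.rTensor Z).rTensor Z = f.rTensor Z ∘ₗ mulLast k V Z := by
    ext; simp
  exact LinearMap.congr_fun this x

theorem mulLast_mulLast (x : ((V ⊗[k] Z) ⊗[k] Z) ⊗[k] Z) :
    mulLast k V Z (mulLast k (V ⊗[k] Z) Z x) =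
      mulLast k V Z ((mulLast k V Z).rTensor Z x) := by
  have : mulLast k V Z ∘ₗ mulLast k (V ⊗[k] Z) Z =
      mulLast k V Z ∘ₗ (mulLast k V Z).rTensor Z := by
    ext; simp [mul_assoc]
  exact LinearMap.congr_fun this x

theorem mulLast_expand {e : C →ₗ[k] k} {h : C →ₗ[k] Z ⊗[k] Z}
    (H : LinearMap.mul' k Z ∘ₗ h = Algebra.linearMap k Z ∘ₗ e) (x : V ⊗[k] C) :
    mulLast k V Z (expand V h x) = contract V e x ⊗ₜ 1 := by
  induction x with
  | zero => simp
  | add x y hx hy => simp only [map_add, hx, hy, add_tmul]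
  | tmul v c =>
    have := LinearMap.congr_fun H c
    simp only [LinearMap.comp_apply, Algebra.linearMap_apply] at this
    rw [expand_tmul]
    simp [mulLast, this, Algebra.algebraMap_eq_smul_one, smul_tmul']

end TensorProduct

end Algebra

end Expand

/-! ### Equalizers and bijectivity under tensoring over a field -/

section Subspace

open TensorProduct

variable {k : Type u} [Field k] {C D V W : Type u}
  [AddCommGroup C] [Module k C] [AddCommGroup D] [Module k D]
  [AddCommGroup V] [Module k V] [AddCommGroup W] [Module k W]

/-- A linear retraction onto a subspace. -/
noncomputable def Submodule.retract (p : Submodule k V) : V →ₗ[k] p :=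
  (p.subtype.exists_leftInverse_of_injective p.ker_subtype).choose

theorem Submodule.retract_comp_subtype (p : Submodule k V) :
    p.retract ∘ₗ p.subtype = LinearMap.id :=
  (p.subtype.exists_leftInverse_of_injective p.ker_subtype).choose_spec

theorem Submodule.rTensor_subtype_injective (p : Submodule k V) :
    Function.Injective (p.subtype.rTensor C) :=
  Module.Flat.rTensor_preserves_injective_linearMap _ p.injective_subtype

theorem Submodule.rTensor_rTensor_subtype_injective (p : Submodule k V) :
    Function.Injective ((p.subtype.rTensor C).rTensor D) :=
  Module.Flat.rTensor_preserves_injective_linearMap _ p.rTensor_subtype_injective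

/-- By flatness an element equalized by `f ⊗ C` and `g ⊗ C` already lies in `eqLocus f g ⊗ C`, where
the retraction is the identity. Maps into `eqLocus f g ⊗ C` can thus be defined with an arbitrary
retraction and then computed in `V ⊗ C`. -/
theorem LinearMap.rTensor_subtype_retract_eqLocus (f g : V →ₗ[k] W) {x : V ⊗[k] C}
    (hx : f.rTensor C x = g.rTensor C x) :
    (eqLocus f g).subtype.rTensor C ((eqLocus f g).retract.rTensor C x) = x := by
  have hex : Function.Exact (eqLocus f g).subtype (f - g) := by
    intro y
    simp [sub_eq_zero]
  have h0 : (f - g).rTensor C x = 0 := by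
    rw [LinearMap.rTensor_sub, LinearMap.sub_apply, hx, sub_self]
  obtain ⟨y, rfl⟩ := (Module.Flat.rTensor_exact C hex x).1 h0
  have h1 : (eqLocus f g).retract.rTensor C ((eqLocus f g).subtype.rTensor C y) = y := by
    rw [← LinearMap.rTensor_comp_apply, Submodule.retract_comp_subtype, LinearMap.rTensor_id]
    rfl
  rw [h1]

theorem LinearMap.bijective_of_rTensor_bijective [Nontrivial C] {f : V →ₗ[k] W}
    (hf : Function.Bijective (f.rTensor C)) : Function.Bijective f := by
  rw [← Module.FaithfullyFlat.lTensor_bijective_iff_bijective k C,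
    ← LinearMap.comm_comp_rTensor_comp_comm_eq]
  exact (TensorProduct.comm k W C).bijective.comp
    (hf.comp (TensorProduct.comm k C V).bijective)

end Subspace

/-! ### Comodule laws in leg notation -/

namespace Comod

open TensorProduct

variable {k : Type u} [Field k] {A : Type u} [Ring A] [Bialgebra k A]

theorem rTensor_coact_coact (V : Comod k A) (v : V.carrier) :
    V.coact.rTensor A (V.coact v) = expand V.carrier Coalgebra.comul (V.coact v) := by
  rw [expand, LinearMap.comp_apply, LinearEquiv.coe_coe, LinearEquiv.eq_symm_apply]
  exact LinearMap.congr_fun V.coassoc v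

theorem contract_coact (V : Comod k A) (v : V.carrier) :
    contract V.carrier (Coalgebra.counit (R := k) (A := A)) (V.coact v) = v := by
  have := LinearMap.congr_fun V.counit v
  simp only [LinearMap.comp_apply] at this
  simp [contract, this]

/-- A comodule from the coassociativity and counit laws in terms of `expand` and `contract`. -/
noncomputable abbrev ofExpand (V : Type u) [AddCommGroup V] [Module k V] (ρ : V →ₗ[k] V ⊗[k] A)
    (h₁ : ∀ v, ρ.rTensor A (ρ v) = expand V Coalgebra.comul (ρ v))
    (h₂ : ∀ v, contract V (Coalgebra.counit (R := k) (A := A)) (ρ v) = v) : Comod k A where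
  carrier := V
  coact := ρ
  coassoc := LinearMap.ext fun v => by
    have := h₁ v
    rwa [expand, LinearMap.comp_apply, LinearEquiv.coe_coe, LinearEquiv.eq_symm_apply] at this
  counit := LinearMap.ext fun v => by
    have := h₂ v
    rw [contract, LinearMap.comp_apply, LinearEquiv.coe_coe] at this
    rw [LinearMap.comp_apply, ← LinearEquiv.eq_symm_apply] at *
    rw [this]
    simp

theorem colinear_apply {V W : Comod k A} (f : V ⟶ W) (v : V.carrier) :
    W.coact (f.lin v) = f.lin.rTensor A (V.coact v) :=
  LinearMap.congr_fun f.colinear v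

theorem contract_comul {V : Type u} [AddCommMonoid V] [Module k V] (x : V ⊗[k] A) :
    contract (V ⊗[k] A) (Coalgebra.counit (R := k) (A := A))
      (expand V Coalgebra.comul x) = x :=
  contract_expand Coalgebra.lTensor_counit_comp_comul x

end Comod

/-! ### Translation maps and their identities -/

namespace HopfGaloisSystem

open TensorProduct

variable {k : Type u} [Field k] {A B Z T : Type u}
    [Ring A] [Bialgebra k A] [Ring B] [Bialgebra k B] [Ring Z] [Algebra k Z]
    [Ring T] [Algebra k T] (H : HopfGaloisSystem k A B Z T)
    {V : Type u} [AddCommMonoid V] [Module k V]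

/-- The translation map `A → Z ⊗ Z` of the left `A`-Galois object `Z`. -/
noncomputable def j : A →ₗ[k] Z ⊗[k] Z := H.S.lTensor Z ∘ₗ H.γ.toLinearMap

/-- The translation map `B → Z ⊗ Z` of the right `B`-Galois object `Z`. -/
noncomputable def i : B →ₗ[k] Z ⊗[k] Z := H.S.rTensor Z ∘ₗ H.δ.toLinearMap

/-- This is (α ⊗ 1)j = (1 ⊗ j)Δ: apply `S` to the `T`-leg of `γ_comul`. -/
theorem expand_α_expand_j (x : V ⊗[k] A) :
    (expand V H.α.toLinearMap).rTensor Z (expand V H.j x) =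
      expand (V ⊗[k] A) H.j (expand V Coalgebra.comul x) := by
  refine expand_rTensor_expand ?_ x
  have e : ∀ t : Z ⊗[k] T, TensorProduct.assoc k A Z Z (H.α.toLinearMap.rTensor Z
      (H.S.lTensor Z t)) = (H.S.lTensor Z).lTensor A
        (TensorProduct.assoc k A Z T (H.α.toLinearMap.rTensor T t)) := by
    intro t
    induction t with
    | zero => simp
    | add x y hx hy => simp only [map_add, hx, hy]
    | tmul z t =>
      simp only [LinearMap.lTensor_tmul, LinearMap.rTensor_tmul]
      generalize H.α.toLinearMap z = s
      induction s with
      | zero => simp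
      | add x y hx hy => simp only [map_add, add_tmul, hx, hy]
      | tmul z t => simp
  ext a
  have := LinearMap.congr_fun H.γ_comul a
  simp only [LinearMap.comp_apply, LinearEquiv.coe_coe, j, LinearMap.lTensor_comp] at this ⊢
  rw [e, ← this]

theorem expand_β_expand_i (x : V ⊗[k] B) :
    expand (V ⊗[k] Z) H.β.toLinearMap (expand V H.i x) =
      (expand V H.i).rTensor B (expand V Coalgebra.comul x) := by
  refine (expand_rTensor_expand ?_ x).symm
  have e : ∀ t : T ⊗[k] Z, H.β.toLinearMap.lTensor Z (H.S.rTensor Z t) =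
      H.S.rTensor (Z ⊗[k] B) (H.β.toLinearMap.lTensor T t) := by
    intro t
    rw [← LinearMap.comp_apply, ← LinearMap.comp_apply, LinearMap.lTensor_comp_rTensor,
      LinearMap.rTensor_comp_lTensor]
  have e' : ∀ t : (T ⊗[k] Z) ⊗[k] B, TensorProduct.assoc k Z Z B ((H.S.rTensor Z).rTensor B t) =
      H.S.rTensor (Z ⊗[k] B) (TensorProduct.assoc k T Z B t) := by
    intro t
    have : (TensorProduct.assoc k Z Z B).toLinearMap ∘ₗ (H.S.rTensor Z).rTensor B =
        H.S.rTensor (Z ⊗[k] B) ∘ₗ (TensorProduct.assoc k T Z B).toLinearMap := by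
      ext; simp
    exact LinearMap.congr_fun this t
  ext a
  have := LinearMap.congr_fun H.δ_comul a
  simp only [LinearMap.comp_apply, LinearEquiv.coe_coe, i, LinearMap.rTensor_comp] at this ⊢
  rw [e, ← this, e']

/-- This is (j ⊗ 1)α = (1 ⊗ i)β: apply `S` to the middle leg of `γ_α`. It is the only link between
the `A`-side and the `B`-side translation maps. -/
theorem expand_j_expand_α (x : V ⊗[k] Z) :
    (expand V H.j).rTensor Z (expand V H.α.toLinearMap x) =
      expand (V ⊗[k] Z) H.i (expand V H.β.toLinearMap x) := by
  refine expand_rTensor_expand ?_ x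
  have e : ∀ t : (Z ⊗[k] T) ⊗[k] Z, TensorProduct.assoc k Z Z Z ((H.S.lTensor Z).rTensor Z t) =
      (H.S.rTensor Z).lTensor Z (TensorProduct.assoc k Z T Z t) := by
    intro t
    have : (TensorProduct.assoc k Z Z Z).toLinearMap ∘ₗ (H.S.lTensor Z).rTensor Z =
        (H.S.rTensor Z).lTensor Z ∘ₗ (TensorProduct.assoc k Z T Z).toLinearMap := by
      ext; simp
    exact LinearMap.congr_fun this t
  ext a
  have := LinearMap.congr_fun H.γ_α a
  simp only [LinearMap.comp_apply, LinearEquiv.coe_coe, i, j, LinearMap.rTensor_comp,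
    LinearMap.lTensor_comp] at this ⊢
  rw [e, ← this]

theorem rTensor_expand_j_expand_α (x : (V ⊗[k] Z) ⊗[k] Z) :
    ((expand V H.j).rTensor Z).rTensor Z ((expand V H.α.toLinearMap).rTensor Z x) =
      (expand (V ⊗[k] Z) H.i).rTensor Z ((expand V H.β.toLinearMap).rTensor Z x) :=
  LinearMap.rTensor_rTensor_congr H.expand_j_expand_α x

theorem expand_α_expand_β (x : V ⊗[k] Z) :
    (expand V H.α.toLinearMap).rTensor B (expand V H.β.toLinearMap x) =
      expand (V ⊗[k] A) H.β.toLinearMap (expand V H.α.toLinearMap x) :=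
  expand_rTensor_expand H.bicomodule x

theorem expand_β_expand_β (x : V ⊗[k] Z) :
    (expand V H.β.toLinearMap).rTensor B (expand V H.β.toLinearMap x) =
      expand (V ⊗[k] Z) Coalgebra.comul (expand V H.β.toLinearMap x) :=
  expand_rTensor_expand H.β_coassoc x

theorem contract_expand_β (x : V ⊗[k] Z) :
    contract (V ⊗[k] Z) Coalgebra.counit (expand V H.β.toLinearMap x) = x :=
  contract_expand H.β_counit x

theorem contract_expand_α (x : V ⊗[k] Z) :
    (contract V Coalgebra.counit).rTensor Z (expand V H.α.toLinearMap x) = x :=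
  contract_rTensor_expand H.α_counit x

theorem mulLast_expand_j (x : V ⊗[k] A) :
    mulLast k V Z (expand V H.j x) = contract V Coalgebra.counit x ⊗ₜ 1 :=
  mulLast_expand H.S_γ x

theorem mulLast_expand_i (x : V ⊗[k] B) :
    mulLast k V Z (expand V H.i x) = contract V Coalgebra.counit x ⊗ₜ 1 :=
  mulLast_expand H.S_δ x

theorem exists_functional (H : HopfGaloisSystem k A B Z T) : ∃ φ : Z →ₗ[k] k, φ 1 = 1 := by
  have := H.nontrivial_Z
  obtain ⟨φ, hφ⟩ := (Algebra.linearMap k Z).exists_leftInverse_of_injective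
    (LinearMap.ker_eq_bot.2 (algebraMap k Z).injective)
  exact ⟨φ, by simpa using LinearMap.congr_fun hφ 1⟩

/-- A linear functional on `Z` with value `1` at `1`. -/
noncomputable def φ : Z →ₗ[k] k := H.exists_functional.choose

theorem contract_φ_tmul_one (v : V) : contract V H.φ (v ⊗ₜ 1) = v := by
  rw [contract_tmul, φ, H.exists_functional.choose_spec, one_smul]

theorem tmul_one_injective (H : HopfGaloisSystem k A B Z T) {v w : V}
    (h : v ⊗ₜ[k] (1 : Z) = w ⊗ₜ 1) : v = w := by
  rw [← H.contract_φ_tmul_one v, h, contract_φ_tmul_one]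

variable (V) in
/-- A retraction of `expand V H.j`. -/
noncomputable def unj : (V ⊗[k] Z) ⊗[k] Z →ₗ[k] V ⊗[k] A :=
  contract (V ⊗[k] A) H.φ ∘ₗ mulLast k (V ⊗[k] A) Z ∘ₗ (expand V H.α.toLinearMap).rTensor Z

/-- The canonical map z ⊗ z' ↦ α(z)(1 ⊗ z') sends j(a) to a₁ ⊗ m(j(a₂)) = a ⊗ 1, and `φ` removes the
1. -/
theorem unj_expand_j (x : V ⊗[k] A) : H.unj V (expand V H.j x) = x := by
  simp only [unj, LinearMap.comp_apply, expand_α_expand_j, mulLast_expand_j,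
    contract_φ_tmul_one]
  exact Comod.contract_comul x

theorem expand_j_injective : Function.Injective (expand V H.j) :=
  fun x y h => by rw [← H.unj_expand_j x, h, unj_expand_j]

/-- Descent criterion for the image of `j`. Applying `j` after `unj` produces (j ⊗ 1)α on the first
`Z`-leg, which is (1 ⊗ i)β; the hypothesis collapses the product with the last leg to x ⊗ 1. -/
theorem expand_j_unj {x : (V ⊗[k] Z) ⊗[k] Z}
    (hx : mulLast k ((V ⊗[k] Z) ⊗[k] Z) Z ((expand (V ⊗[k] Z) H.i).rTensor Z
      ((expand V H.β.toLinearMap).rTensor Z x)) = x ⊗ₜ 1) :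
    expand V H.j (H.unj V x) = x := by
  simp only [unj, LinearMap.comp_apply]
  rw [← contract_rTensor, ← mulLast_rTensor,
    rTensor_expand_j_expand_α, hx, contract_φ_tmul_one]

theorem expand_j_expand_comul (x : V ⊗[k] A) :
    expand ((V ⊗[k] Z) ⊗[k] Z) H.j ((expand V H.j).rTensor A (expand V Coalgebra.comul x)) =
      (expand (V ⊗[k] Z) H.i).rTensor Z
        ((expand V H.β.toLinearMap).rTensor Z (expand V H.j x)) := by
  rw [expand_rTensor, ← expand_α_expand_j,
    rTensor_expand_j_expand_α]

end HopfGaloisSystem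

namespace HopfGaloisSystem

open TensorProduct CategoryTheory

variable {k : Type u} [Field k] {A B Z T : Type u}
    [Ring A] [Bialgebra k A] [Ring B] [Bialgebra k B] [Ring Z] [Algebra k Z]
    [Ring T] [Algebra k T] (H : HopfGaloisSystem k A B Z T)

/-! ### The cotensor functor -/

section Cotensor

variable (V V' : Comod k A)

/-- The cotensor product `V □ Z` over `A`, as a subspace of `V ⊗ Z`. -/
noncomputable abbrev cotensor : Submodule k (V.carrier ⊗[k] Z) :=
  LinearMap.eqLocus (V.coact.rTensor Z) (expand V.carrier H.α.toLinearMap)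

variable {V V'}

theorem mem_cotensor {x : V.carrier ⊗[k] Z} : x ∈ H.cotensor V ↔
    V.coact.rTensor Z x = expand V.carrier H.α.toLinearMap x := Iff.rfl

variable (V) in
/-- The right coaction of `B` on the cotensor product `V □ Z`. -/
noncomputable def cotensorCoact : H.cotensor V →ₗ[k] H.cotensor V ⊗[k] B :=
  (H.cotensor V).retract.rTensor B ∘ₗ expand V.carrier H.β.toLinearMap ∘ₗ (H.cotensor V).subtype

/-- Since α and β commute, 1 ⊗ β carries `V □ Z` into `(V □ Z) ⊗ B`, so the retraction in the
definition changes nothing. -/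
theorem subtype_cotensorCoact (x : H.cotensor V) :
    (H.cotensor V).subtype.rTensor B (H.cotensorCoact V x) =
      expand V.carrier H.β.toLinearMap ((H.cotensor V).subtype x) := by
  refine LinearMap.rTensor_subtype_retract_eqLocus _ _ ?_
  rw [LinearMap.comp_apply, expand_α_expand_β, ← expand_rTensor]
  exact congrArg _ x.2

variable (V) in
/-- The right `B`-comodule `V □ Z`. -/
noncomputable abbrev cotensorObj : Comod k B :=
  Comod.ofExpand (H.cotensor V) (H.cotensorCoact V)
    (fun v => by
      apply Submodule.rTensor_rTensor_subtype_injective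
      rw [LinearMap.rTensor_rTensor_congr (C := B) H.subtype_cotensorCoact,
        ← expand_rTensor, subtype_cotensorCoact, expand_β_expand_β])
    (fun v => by
      apply Submodule.injective_subtype
      rw [← contract_rTensor, subtype_cotensorCoact, contract_expand_β])

/-- The map `V □ Z → V' □ Z` induced by a colinear map. -/
noncomputable def cotensorMap (f : V ⟶ V') : H.cotensor V →ₗ[k] H.cotensor V' :=
  (f.lin.rTensor Z).restrict fun x hx => by
    rw [mem_cotensor] at *
    rw [expand_rTensor, ← hx]
    exact LinearMap.rTensor_rTensor_congr (C := Z) (Comod.colinear_apply f) x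

theorem subtype_cotensorMap (f : V ⟶ V') (x : H.cotensor V) :
    (H.cotensor V').subtype (H.cotensorMap f x) = f.lin.rTensor Z ((H.cotensor V).subtype x) :=
  rfl

/-- The functor `V ↦ V □ Z` from right `A`-comodules to right `B`-comodules. -/
noncomputable def cotensorFunctor : Comod k A ⥤ Comod k B where
  obj V := H.cotensorObj V
  map {V V'} f := ⟨H.cotensorMap f, LinearMap.ext fun x => by
    change H.cotensorCoact V' (H.cotensorMap f x) =
      (H.cotensorMap f).rTensor B (H.cotensorCoact V x)
    apply Submodule.rTensor_subtype_injective
    rw [subtype_cotensorCoact,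
      LinearMap.rTensor_rTensor_congr (C := B) (H.subtype_cotensorMap f),
      subtype_cotensorCoact, subtype_cotensorMap, expand_rTensor]⟩
  map_id V := Comod.hom_ext <| LinearMap.ext fun x => by
    apply Submodule.injective_subtype
    change (LinearMap.id.rTensor Z) _ = _
    rw [LinearMap.rTensor_id]
    rfl
  map_comp f g := Comod.hom_ext <| LinearMap.ext fun x => by
    apply Submodule.injective_subtype
    change ((g.lin ∘ₗ f.lin).rTensor Z) _ = _
    rw [LinearMap.rTensor_comp]
    rfl

variable (V) in
/-- The colinear translation map `v ↦ v₀ ⊗ j(v₁)`. -/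
noncomputable def transA : V.carrier →ₗ[k] (V.carrier ⊗[k] Z) ⊗[k] Z :=
  expand V.carrier H.j ∘ₗ V.coact

theorem transA_apply (v : V.carrier) : H.transA V v = expand V.carrier H.j (V.coact v) := rfl

/-- Shows that v₀ ⊗ j(v₁) lies in `(V □ Z) ⊗ Z`, which makes the unit of the equivalence well
defined. -/
theorem expand_α_transA (v : V.carrier) :
    (expand V.carrier H.α.toLinearMap).rTensor Z (H.transA V v) =
      (V.coact.rTensor Z).rTensor Z (H.transA V v) := by
  rw [transA_apply, expand_α_expand_j, ← Comod.rTensor_coact_coact, expand_rTensor]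

theorem mulLast_transA (v : V.carrier) :
    mulLast k V.carrier Z (H.transA V v) = v ⊗ₜ 1 := by
  rw [transA_apply, mulLast_expand_j, Comod.contract_coact]

end Cotensor

/-! ### The inverse functor, defined by a descent equation -/

section Inverse

variable (W W' : Comod k B)

/-- The translation map `w ↦ w₀ ⊗ i(w₁)`. -/
noncomputable def transB : W.carrier →ₗ[k] (W.carrier ⊗[k] Z) ⊗[k] Z :=
  expand W.carrier H.i ∘ₗ W.coact

/-- The space of all `∑ w ⊗ z` in `W ⊗ Z` with `∑ w₀ ⊗ i(w₁) z = ∑ w ⊗ z ⊗ 1`, the cotensor product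
of `W` with the inverse of the bi-Galois object `Z`. -/
noncomputable abbrev cotensorInv : Submodule k (W.carrier ⊗[k] Z) :=
  LinearMap.eqLocus (mulLast k (W.carrier ⊗[k] Z) Z ∘ₗ (H.transB W).rTensor Z)
    ((TensorProduct.mk k (W.carrier ⊗[k] Z) Z).flip 1)

variable {W W'}

theorem mem_cotensorInv {x : W.carrier ⊗[k] Z} : x ∈ H.cotensorInv W ↔
    mulLast k (W.carrier ⊗[k] Z) Z ((H.transB W).rTensor Z x) = x ⊗ₜ 1 := Iff.rfl

theorem transB_apply (w : W.carrier) : H.transB W w = expand W.carrier H.i (W.coact w) := rfl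

theorem mulLast_transB (w : W.carrier) :
    mulLast k W.carrier Z (H.transB W w) = w ⊗ₜ 1 := by
  rw [transB_apply, mulLast_expand_i, Comod.contract_coact]

theorem transB_colinear (f : W ⟶ W') (w : W.carrier) :
    H.transB W' (f.lin w) = (f.lin.rTensor Z).rTensor Z (H.transB W w) := by
  rw [transB_apply, Comod.colinear_apply, expand_rTensor, transB_apply]

theorem expand_β_transB (w : W.carrier) :
    expand (W.carrier ⊗[k] Z) H.β.toLinearMap (H.transB W w) =
      (H.transB W).rTensor B (W.coact w) := by
  rw [transB_apply, expand_β_expand_i, ← Comod.rTensor_coact_coact]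
  exact (LinearMap.rTensor_comp_apply _ _ _ _).symm

theorem expand_i_expand_β_transB (w : W.carrier) :
    expand ((W.carrier ⊗[k] Z) ⊗[k] Z) H.i
        (expand (W.carrier ⊗[k] Z) H.β.toLinearMap (H.transB W w)) =
      ((H.transB W).rTensor Z).rTensor Z (H.transB W w) := by
  rw [expand_β_transB, expand_rTensor]
  rfl

theorem rTensor_expand_i_expand_β_transB (x : W.carrier ⊗[k] Z) :
    (expand ((W.carrier ⊗[k] Z) ⊗[k] Z) H.i).rTensor Z
        ((expand (W.carrier ⊗[k] Z) H.β.toLinearMap).rTensor Z ((H.transB W).rTensor Z x)) =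
      (((H.transB W).rTensor Z).rTensor Z).rTensor Z ((H.transB W).rTensor Z x) := by
  simp only [← LinearMap.rTensor_comp_apply]
  congr 2
  exact LinearMap.ext fun w => H.expand_i_expand_β_transB w

theorem expand_j_expand_α_transB (w : W.carrier) :
    (expand (W.carrier ⊗[k] Z) H.j).rTensor Z
        (expand (W.carrier ⊗[k] Z) H.α.toLinearMap (H.transB W w)) =
      ((H.transB W).rTensor Z).rTensor Z (H.transB W w) := by
  rw [expand_j_expand_α, expand_i_expand_β_transB]

/-- Iterating the translation map amounts to applying α and then `j` to the middle leg of w₀ ⊗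
i(w₁), and m j = ε collapses this by the counit of α. Hence w₀ ⊗ i(w₁) lies in `H.cotensorInv W ⊗
Z`. -/
theorem mulLast_transB_transB (w : W.carrier) :
    (mulLast k (W.carrier ⊗[k] Z) Z ∘ₗ (H.transB W).rTensor Z).rTensor Z (H.transB W w) =
      ((TensorProduct.mk k (W.carrier ⊗[k] Z) Z).flip 1).rTensor Z (H.transB W w) := by
  rw [LinearMap.rTensor_comp_apply, ← expand_j_expand_α_transB,
    LinearMap.rTensor_rTensor_congr (C := Z)
      (g' := (TensorProduct.mk k (W.carrier ⊗[k] Z) Z).flip 1) H.mulLast_expand_j,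
    contract_expand_α]

variable (W) in
/-- The map `W ⊗ Z → W ⊗ Z ⊗ A` that restricts to the coaction on `H.cotensorInv W`. -/
noncomputable def preCoact : W.carrier ⊗[k] Z →ₗ[k] (W.carrier ⊗[k] Z) ⊗[k] A :=
  H.unj (W.carrier ⊗[k] Z) ∘ₗ (H.transB W).rTensor Z

theorem expand_j_preCoact {x : W.carrier ⊗[k] Z} (hx : x ∈ H.cotensorInv W) :
    expand (W.carrier ⊗[k] Z) H.j (H.preCoact W x) = (H.transB W).rTensor Z x := by
  refine H.expand_j_unj ?_
  rw [rTensor_expand_i_expand_β_transB, mulLast_rTensor, H.mem_cotensorInv.1 hx,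
    LinearMap.rTensor_tmul]

variable (W) in
/-- The right coaction of `A` on `H.cotensorInv W`. -/
noncomputable def cotensorInvCoact : H.cotensorInv W →ₗ[k] H.cotensorInv W ⊗[k] A :=
  (H.cotensorInv W).retract.rTensor A ∘ₗ H.preCoact W ∘ₗ (H.cotensorInv W).subtype

theorem subtype_cotensorInvCoact (x : H.cotensorInv W) :
    (H.cotensorInv W).subtype.rTensor A (H.cotensorInvCoact W x) =
      H.preCoact W ((H.cotensorInv W).subtype x) := by
  refine LinearMap.rTensor_subtype_retract_eqLocus _ _ ?_
  apply H.expand_j_injective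
  rw [expand_rTensor, expand_rTensor]
  erw [expand_j_preCoact _ x.2]
  simp only [← LinearMap.rTensor_comp_apply]
  congr 2
  refine LinearMap.ext fun w => ?_
  exact H.mulLast_transB_transB w

theorem expand_j_cotensorInvCoact (x : H.cotensorInv W) :
    expand (W.carrier ⊗[k] Z) H.j
        ((H.cotensorInv W).subtype.rTensor A (H.cotensorInvCoact W x)) =
      (H.transB W).rTensor Z ((H.cotensorInv W).subtype x) := by
  rw [subtype_cotensorInvCoact]
  exact H.expand_j_preCoact x.2

variable (W) in
/-- The right `A`-comodule `H.cotensorInv W`. -/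
noncomputable abbrev cotensorInvObj : Comod k A :=
  Comod.ofExpand (H.cotensorInv W) (H.cotensorInvCoact W)
    (fun v => by
      apply Submodule.rTensor_rTensor_subtype_injective
      rw [LinearMap.rTensor_rTensor_congr (C := A) H.subtype_cotensorInvCoact,
        ← expand_rTensor]
      -- Coassociativity is tested after applying `j` to both `A`-legs; both sides then become
      -- iterated translation maps on `W`.
      have inj : Function.Injective ((expand (W.carrier ⊗[k] Z) H.j).rTensor A) :=
        Module.Flat.rTensor_preserves_injective_linearMap _ H.expand_j_injective
      apply inj
      apply H.expand_j_injective
      rw [expand_j_expand_comul, expand_j_cotensorInvCoact, rTensor_expand_i_expand_β_transB,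
        ← expand_j_cotensorInvCoact, ← expand_rTensor]
      congr 1
      simp only [← LinearMap.rTensor_comp_apply]
      congr 2
      refine LinearMap.ext fun w => ?_
      exact H.expand_j_preCoact w.2)
    (fun v => by
      apply Submodule.injective_subtype
      rw [← contract_rTensor]
      -- As m j = ε, the counit law tensored with 1 is the defining equation of `H.cotensorInv W`.
      apply H.tmul_one_injective
      rw [← H.mulLast_expand_j, expand_j_cotensorInvCoact]
      exact v.2)

/-- The map `H.cotensorInv W → H.cotensorInv W'` induced by a colinear map. -/
noncomputable def cotensorInvMap (f : W ⟶ W') : H.cotensorInv W →ₗ[k] H.cotensorInv W' :=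
  (f.lin.rTensor Z).restrict fun x hx => by
    rw [mem_cotensorInv] at *
    rw [LinearMap.rTensor_rTensor_congr (C := Z) (H.transB_colinear f), mulLast_rTensor, hx,
      LinearMap.rTensor_tmul]

theorem subtype_cotensorInvMap (f : W ⟶ W') (x : H.cotensorInv W) :
    (H.cotensorInv W').subtype (H.cotensorInvMap f x) =
      f.lin.rTensor Z ((H.cotensorInv W).subtype x) :=
  rfl

/-- The functor `W ↦ H.cotensorInv W` from right `B`-comodules to right `A`-comodules. -/
noncomputable def cotensorInvFunctor : Comod k B ⥤ Comod k A where
  obj W := H.cotensorInvObj W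
  map {W W'} f := ⟨H.cotensorInvMap f, LinearMap.ext fun x => by
    change H.cotensorInvCoact W' (H.cotensorInvMap f x) =
      (H.cotensorInvMap f).rTensor A (H.cotensorInvCoact W x)
    apply Submodule.rTensor_subtype_injective
    apply H.expand_j_injective
    rw [expand_j_cotensorInvCoact,
      LinearMap.rTensor_rTensor_congr (C := A) (H.subtype_cotensorInvMap f),
      expand_rTensor, expand_j_cotensorInvCoact, subtype_cotensorInvMap,
      LinearMap.rTensor_rTensor_congr (C := Z) (H.transB_colinear f)]⟩
  map_id V := Comod.hom_ext <| LinearMap.ext fun x => by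
    apply Submodule.injective_subtype
    change (LinearMap.id.rTensor Z) _ = _
    rw [LinearMap.rTensor_id]
    rfl
  map_comp f g := Comod.hom_ext <| LinearMap.ext fun x => by
    apply Submodule.injective_subtype
    change ((g.lin ∘ₗ f.lin).rTensor Z) _ = _
    rw [LinearMap.rTensor_comp]
    rfl

end Inverse

/-! ### Unit and counit of the equivalence -/

section Equivalence

variable (V : Comod k A) (W : Comod k B)

theorem transA_colinear {V V' : Comod k A} (f : V ⟶ V') (v : V.carrier) :
    H.transA V' (f.lin v) = (f.lin.rTensor Z).rTensor Z (H.transA V v) := by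
  rw [transA_apply, Comod.colinear_apply, expand_rTensor, transA_apply]

/-- The map `v ↦ v₀ ⊗ j(v₁)` from `V` to `(V □ Z) ⊗ Z`. -/
noncomputable def unitLin : V.carrier →ₗ[k] H.cotensor V ⊗[k] Z :=
  (H.cotensor V).retract.rTensor Z ∘ₗ H.transA V

variable {V} in
theorem subtype_unitLin (v : V.carrier) :
    (H.cotensor V).subtype.rTensor Z (H.unitLin V v) = H.transA V v :=
  LinearMap.rTensor_subtype_retract_eqLocus _ _ (H.expand_α_transA v).symm

theorem subtype_transB_cotensorObj (x : H.cotensor V) :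
    ((H.cotensor V).subtype.rTensor Z).rTensor Z (H.transB (H.cotensorObj V) x) =
      expand (V.carrier ⊗[k] Z) H.i
        (expand V.carrier H.β.toLinearMap ((H.cotensor V).subtype x)) := by
  rw [transB_apply, ← expand_rTensor]
  exact congrArg _ (H.subtype_cotensorCoact x)

/-- On `V □ Z` one has (1 ⊗ i)β = (j ⊗ 1)α, and α may be traded for the coaction of `V`. So the
`B`-translation of `V □ Z` is the `A`-translation of `V`. -/
theorem rTensor_subtype_transB_cotensorObj (x : H.cotensor V ⊗[k] Z) :
    (((H.cotensor V).subtype.rTensor Z).rTensor Z).rTensor Z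
        ((H.transB (H.cotensorObj V)).rTensor Z x) =
      ((H.transA V).rTensor Z).rTensor Z ((H.cotensor V).subtype.rTensor Z x) := by
  simp only [← LinearMap.rTensor_comp_apply]
  congr 2
  refine LinearMap.ext fun y => ?_
  rw [LinearMap.comp_apply, subtype_transB_cotensorObj, ← expand_j_expand_α]
  rw [Submodule.subtype_apply, ← H.mem_cotensor.1 y.2]
  exact (LinearMap.rTensor_comp_apply _ _ _ _).symm

theorem unitLin_mem (v : V.carrier) : H.unitLin V v ∈ H.cotensorInv (H.cotensorObj V) := by
  rw [mem_cotensorInv]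
  apply Submodule.rTensor_rTensor_subtype_injective
  rw [← mulLast_rTensor, rTensor_subtype_transB_cotensorObj, mulLast_rTensor, subtype_unitLin,
    mulLast_transA, LinearMap.rTensor_tmul, LinearMap.rTensor_tmul, subtype_unitLin]

theorem unitLin_injective : Function.Injective (H.unitLin V) := by
  intro v w h
  apply H.tmul_one_injective
  rw [← H.mulLast_transA, ← subtype_unitLin, h, subtype_unitLin, mulLast_transA]

theorem exists_unitLin_eq {x : H.cotensor V ⊗[k] Z}
    (hx : x ∈ H.cotensorInv (H.cotensorObj V)) : ∃ v, H.unitLin V v = x := by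
  let y := mulLast k V.carrier Z ((H.cotensor V).subtype.rTensor Z x)
  have hy : (H.transA V).rTensor Z y = (H.cotensor V).subtype.rTensor Z x ⊗ₜ 1 := by
    rw [mem_cotensorInv] at hx
    rw [← mulLast_rTensor, ← rTensor_subtype_transB_cotensorObj, mulLast_rTensor, hx,
      LinearMap.rTensor_tmul]
  -- The preimage is φ(m(x)). By `hy` its translation is `φ` applied to the last leg of x ⊗ 1, that
  -- is, x.
  refine ⟨contract V.carrier H.φ y, ?_⟩
  apply Submodule.rTensor_subtype_injective
  rw [subtype_unitLin, ← contract_rTensor, hy, contract_φ_tmul_one]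

/-- The isomorphism from `V` to the image of `V □ Z` under the inverse functor. -/
noncomputable def unitEquiv : V.carrier ≃ₗ[k] H.cotensorInv (H.cotensorObj V) :=
  LinearEquiv.ofBijective ((H.unitLin V).codRestrict _ (H.unitLin_mem V))
    ⟨fun _ _ h => H.unitLin_injective V (congrArg Subtype.val h), fun x =>
      (H.exists_unitLin_eq V x.2).imp fun _ h => Subtype.ext h⟩

variable {V} in
theorem subtype_unitEquiv (v : V.carrier) :
    (H.cotensorInv (H.cotensorObj V)).subtype (H.unitEquiv V v) = H.unitLin V v := rfl

/-- The natural isomorphism `V ≅ H.cotensorInv (V □ Z)`. -/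
noncomputable def unitIso : 𝟭 (Comod k A) ≅ H.cotensorFunctor ⋙ H.cotensorInvFunctor :=
  NatIso.ofComponents
    (fun V => Comod.mkIso (W := H.cotensorInvObj (H.cotensorObj V)) (H.unitEquiv V) <|
      LinearMap.ext fun v => by
        change H.cotensorInvCoact (H.cotensorObj V) (H.unitEquiv V v) =
          (H.unitEquiv V).toLinearMap.rTensor A (V.coact v)
        apply Submodule.rTensor_subtype_injective
        apply H.expand_j_injective
        rw [expand_j_cotensorInvCoact, subtype_unitEquiv]
        rw [LinearMap.rTensor_rTensor_congr (C := A) (f' := LinearMap.id) H.subtype_unitEquiv]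
        rw [LinearMap.rTensor_id, LinearMap.id_apply, expand_rTensor]
        apply Module.Flat.rTensor_preserves_injective_linearMap _
          (H.cotensor V).rTensor_rTensor_subtype_injective
        rw [rTensor_subtype_transB_cotensorObj, subtype_unitLin]
        simp only [← LinearMap.rTensor_comp_apply]
        congr 2
        rw [← LinearMap.rTensor_comp]
        congr 1
        exact LinearMap.ext fun v => (H.subtype_unitLin v).symm)
    (fun {V V'} f => Comod.hom_ext <| LinearMap.ext fun v => by
      apply Submodule.injective_subtype
      apply Submodule.rTensor_subtype_injective
      change (H.cotensor V').subtype.rTensor Z (H.unitLin V' (f.lin v)) =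
        (H.cotensor V').subtype.rTensor Z ((H.cotensorMap f).rTensor Z (H.unitLin V v))
      rw [subtype_unitLin, LinearMap.rTensor_rTensor_congr (C := Z) (H.subtype_cotensorMap f),
        subtype_unitLin, transA_colinear])

/-- The map `w ↦ w₀ ⊗ i(w₁)` from `W` to `H.cotensorInv W ⊗ Z`. -/
noncomputable def counitLin : W.carrier →ₗ[k] H.cotensorInv W ⊗[k] Z :=
  (H.cotensorInv W).retract.rTensor Z ∘ₗ H.transB W

variable {W} in
theorem subtype_counitLin (w : W.carrier) :
    (H.cotensorInv W).subtype.rTensor Z (H.counitLin W w) = H.transB W w :=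
  LinearMap.rTensor_subtype_retract_eqLocus _ _ (H.mulLast_transB_transB w)

theorem rTensor_expand_j_subtype_cotensorInvCoact (x : H.cotensorInv W ⊗[k] Z) :
    (expand (W.carrier ⊗[k] Z) H.j).rTensor Z (((H.cotensorInv W).subtype.rTensor A).rTensor Z
        ((H.cotensorInvCoact W).rTensor Z x)) =
      ((H.transB W).rTensor Z).rTensor Z ((H.cotensorInv W).subtype.rTensor Z x) := by
  simp only [← LinearMap.rTensor_comp_apply]
  congr 2
  exact LinearMap.ext fun y => H.expand_j_cotensorInvCoact y

theorem rTensor_expand_j_injective :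
    Function.Injective ((expand (W.carrier ⊗[k] Z) H.j).rTensor Z) :=
  Module.Flat.rTensor_preserves_injective_linearMap _ H.expand_j_injective

theorem counitLin_mem (w : W.carrier) : H.counitLin W w ∈ H.cotensor (H.cotensorInvObj W) := by
  rw [mem_cotensor]
  apply Submodule.rTensor_rTensor_subtype_injective
  apply H.rTensor_expand_j_injective
  rw [rTensor_expand_j_subtype_cotensorInvCoact, ← expand_rTensor, subtype_counitLin,
    expand_j_expand_α_transB]

theorem counitLin_injective : Function.Injective (H.counitLin W) := by
  intro v w h
  apply H.tmul_one_injective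
  rw [← H.mulLast_transB, ← subtype_counitLin, h, subtype_counitLin, mulLast_transB]

theorem exists_counitLin_eq {x : H.cotensorInv W ⊗[k] Z}
    (hx : x ∈ H.cotensor (H.cotensorInvObj W)) : ∃ w, H.counitLin W w = x := by
  let y := (H.cotensorInv W).subtype.rTensor Z x
  have hy : ((H.transB W).rTensor Z).rTensor Z y = expand ((W.carrier ⊗[k] Z) ⊗[k] Z) H.i
      (expand (W.carrier ⊗[k] Z) H.β.toLinearMap y) := by
    rw [mem_cotensor] at hx
    rw [← rTensor_expand_j_subtype_cotensorInvCoact, ← expand_j_expand_α, expand_rTensor, ← hx]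
  refine ⟨contract W.carrier H.φ (mulLast k W.carrier Z y), ?_⟩
  apply Submodule.rTensor_subtype_injective
  rw [subtype_counitLin, ← contract_rTensor, ← mulLast_rTensor, hy, mulLast_expand_i,
    contract_φ_tmul_one, contract_expand_β]

/-- The isomorphism from `W` to `H.cotensorInv W □ Z`. -/
noncomputable def counitEquiv : W.carrier ≃ₗ[k] H.cotensor (H.cotensorInvObj W) :=
  LinearEquiv.ofBijective ((H.counitLin W).codRestrict _ (H.counitLin_mem W))
    ⟨fun _ _ h => H.counitLin_injective W (congrArg Subtype.val h), fun x =>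
      (H.exists_counitLin_eq W x.2).imp fun _ h => Subtype.ext h⟩

variable {W} in
theorem subtype_counitEquiv (w : W.carrier) :
    (H.cotensor (H.cotensorInvObj W)).subtype (H.counitEquiv W w) = H.counitLin W w := rfl

/-- The natural isomorphism `W ≅ H.cotensorInv W □ Z`. -/
noncomputable def counitIso : 𝟭 (Comod k B) ≅ H.cotensorInvFunctor ⋙ H.cotensorFunctor :=
  NatIso.ofComponents
    (fun W => Comod.mkIso (W := H.cotensorObj (H.cotensorInvObj W)) (H.counitEquiv W) <|
      LinearMap.ext fun w => by
        change H.cotensorCoact (H.cotensorInvObj W) (H.counitEquiv W w) =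
          (H.counitEquiv W).toLinearMap.rTensor B (W.coact w)
        apply Submodule.rTensor_subtype_injective
        rw [subtype_cotensorCoact, subtype_counitEquiv]
        rw [LinearMap.rTensor_rTensor_congr (C := B) (f' := LinearMap.id) H.subtype_counitEquiv]
        rw [LinearMap.rTensor_id, LinearMap.id_apply]
        apply (H.cotensorInv W).rTensor_rTensor_subtype_injective
        rw [← expand_rTensor, subtype_counitLin, expand_β_transB]
        simp only [← LinearMap.rTensor_comp_apply]
        congr 2
        exact LinearMap.ext fun v => (H.subtype_counitLin v).symm)
    (fun {W W'} f => Comod.hom_ext <| LinearMap.ext fun w => by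
      apply Submodule.injective_subtype
      apply Submodule.rTensor_subtype_injective
      change (H.cotensorInv W').subtype.rTensor Z (H.counitLin W' (f.lin w)) =
        (H.cotensorInv W').subtype.rTensor Z ((H.cotensorInvMap f).rTensor Z (H.counitLin W w))
      rw [subtype_counitLin, LinearMap.rTensor_rTensor_congr (C := Z) (H.subtype_cotensorInvMap f),
        subtype_counitLin, transB_colinear])

/-- The equivalence between right `A`-comodules and right `B`-comodules given by cotensoring
with `Z`. -/
noncomputable def comodEquivalence : Comod k A ≌ Comod k B :=
  CategoryTheory.Equivalence.mk H.cotensorFunctor H.cotensorInvFunctor H.unitIso H.counitIso.symm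

end Equivalence

end HopfGaloisSystem

/-! ### Products of legs in diagonal coactions -/

namespace RightComod

open TensorProduct

variable {k : Type u} [Field k] {C D E : Type u} [Ring C] [Algebra k C] [Ring D] [Algebra k D]
  [Ring E] [Algebra k E]
  {V V' W W' : Type u} [AddCommGroup V] [Module k V] [AddCommGroup W] [Module k W]
  [AddCommGroup V'] [Module k V'] [AddCommGroup W'] [Module k W']

theorem gather_rTensor_tmul_rTensor (f : V →ₗ[k] V') (g : W →ₗ[k] W') (x : V ⊗[k] C)
    (y : W ⊗[k] C) : gather k C V' W' (f.rTensor C x ⊗ₜ g.rTensor C y) =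
      (TensorProduct.map f g).rTensor C (gather k C V W (x ⊗ₜ y)) := by
  have := LinearMap.congr_fun (gather_map f g (AlgHom.id k C)) (x ⊗ₜ y)
  rwa [AlgHom.toLinearMap_id] at this

theorem diag_rTensor_gather (ρ : V →ₗ[k] V ⊗[k] C) (σ : W →ₗ[k] W ⊗[k] C) (x : V ⊗[k] D)
    (y : W ⊗[k] D) : (diag ρ σ).rTensor D (gather k D V W (x ⊗ₜ y)) =
      (gather k C V W).rTensor D
        (gather k D (V ⊗[k] C) (W ⊗[k] C) (ρ.rTensor D x ⊗ₜ σ.rTensor D y)) := by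
  rw [gather_rTensor_tmul_rTensor, diag, LinearMap.rTensor_comp_apply]

theorem expand_gather (h : C →ₐ[k] D ⊗[k] E) (x : V ⊗[k] C) (y : W ⊗[k] C) :
    expand (V ⊗[k] W) h.toLinearMap (gather k C V W (x ⊗ₜ y)) =
      (gather k D V W).rTensor E (gather k E (V ⊗[k] D) (W ⊗[k] D)
        (expand V h.toLinearMap x ⊗ₜ expand W h.toLinearMap y)) := by
  have key : ∀ (v : V) (w : W) (s t : D ⊗[k] E),
      (TensorProduct.assoc k (V ⊗[k] W) D E).symm ((v ⊗ₜ w) ⊗ₜ (s * t)) =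
        (gather k D V W).rTensor E (gather k E (V ⊗[k] D) (W ⊗[k] D)
          ((TensorProduct.assoc k V D E).symm (v ⊗ₜ s) ⊗ₜ
            (TensorProduct.assoc k W D E).symm (w ⊗ₜ t))) := by
    intro v w s t
    induction s with
    | zero => simp
    | add s s' h h' => simp only [add_mul, add_tmul, tmul_add, map_add, h, h']
    | tmul d e =>
      induction t with
      | zero => simp
      | add s s' h h' => simp only [mul_add, tmul_add, map_add, h, h']
      | tmul d' e' => simp
  induction x with
  | zero => simp
  | add x x' h h' => simp only [add_tmul, map_add, h, h']
  | tmul v c =>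
    induction y with
    | zero => simp
    | add x x' h h' => simp only [tmul_add, map_add, h, h']
    | tmul w d =>
      rw [gather_tmul, expand_tmul, expand_tmul, expand_tmul, ← key]
      simp only [AlgHom.toLinearMap_apply, map_mul]

theorem lid_gather (c : k) (x : V ⊗[k] C) :
    (TensorProduct.lid k V).toLinearMap.rTensor C (gather k C k V ((c ⊗ₜ 1) ⊗ₜ x)) = c • x := by
  induction x with
  | zero => simp
  | add x y hx hy => simp only [tmul_add, map_add, hx, hy, smul_add]
  | tmul v a => simp [smul_tmul']

theorem rid_gather (c : k) (x : V ⊗[k] C) :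
    (TensorProduct.rid k V).toLinearMap.rTensor C (gather k C V k (x ⊗ₜ (c ⊗ₜ 1))) = c • x := by
  induction x with
  | zero => simp
  | add x y hx hy => simp only [add_tmul, map_add, hx, hy, smul_add]
  | tmul v a => simp [smul_tmul']

/-- The associativity (xy)c = x(yc), with the permutations of legs spelled out; it lets `W` and then
`V` be descended separately. -/
theorem mulLast_gather (x : V ⊗[k] C) (y : W ⊗[k] C) (c : C) :
    mulLast k (V ⊗[k] W) C (gather k C V W (x ⊗ₜ y) ⊗ₜ c) =
      (TensorProduct.assoc k V W C).symm (TensorProduct.leftComm k W V C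
        ((mulLast k V C).lTensor W (TensorProduct.leftComm k (V ⊗[k] C) W C
          (x ⊗ₜ mulLast k W C (y ⊗ₜ c))))) := by
  induction x with
  | zero => simp
  | add x x' h h' => simp only [add_tmul, map_add, h, h']
  | tmul v a =>
    induction y with
    | zero => simp
    | add x x' h h' => simp only [add_tmul, tmul_add, map_add, h, h']
    | tmul w b => simp [mul_assoc]

end RightComod

namespace HopfGaloisSystem

open TensorProduct CategoryTheory RightComod

variable {k : Type u} [Field k] {A B Z T : Type u}
    [Ring A] [Bialgebra k A] [Ring B] [Bialgebra k B] [Ring Z] [Algebra k Z]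
    [Ring T] [Algebra k T] (H : HopfGaloisSystem k A B Z T) (V W : Comod k A)

/-! ### Descent: trivializing the cotensor product after tensoring with `Z` -/

section Descent

variable {V} in
theorem mulLast_transA_cotensor (x : H.cotensor V) :
    mulLast k (V.carrier ⊗[k] Z) Z ((H.transA V).rTensor Z ((H.cotensor V).subtype x)) =
      (H.cotensor V).subtype x ⊗ₜ 1 := by
  rw [transA, LinearMap.rTensor_comp_apply, Submodule.subtype_apply, H.mem_cotensor.1 x.2,
    expand_j_expand_α, mulLast_expand_i, contract_expand_β]

/-- The multiplication map `(V □ Z) ⊗ Z → V ⊗ Z`. -/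
noncomputable def descentLin : H.cotensor V ⊗[k] Z →ₗ[k] V.carrier ⊗[k] Z :=
  mulLast k V.carrier Z ∘ₗ (H.cotensor V).subtype.rTensor Z

theorem mulLast_rTensor_tmul_one {M : Type u} [AddCommMonoid M] [Module k M] (x : M ⊗[k] Z) :
    mulLast k M Z (((TensorProduct.mk k M Z).flip 1).rTensor Z x) = x := by
  induction x with
  | zero => simp
  | add x y hx hy => simp only [map_add, hx, hy]
  | tmul v a => simp

/-- The isomorphism `(V □ Z) ⊗ Z ≃ V ⊗ Z`. -/
noncomputable def descentEquiv : (H.cotensor V ⊗[k] Z) ≃ₗ[k] V.carrier ⊗[k] Z :=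
  LinearEquiv.ofLinearMap (H.descentLin V) (mulLast k (H.cotensor V) Z ∘ₗ (H.unitLin V).rTensor Z)
    (LinearMap.ext fun x => by
      change mulLast k V.carrier Z ((H.cotensor V).subtype.rTensor Z
        (mulLast k (H.cotensor V) Z ((H.unitLin V).rTensor Z x))) = x
      have e : ((H.cotensor V).subtype.rTensor Z).rTensor Z ((H.unitLin V).rTensor Z x) =
          (H.transA V).rTensor Z x := by
        rw [← LinearMap.rTensor_comp_apply]
        congr 2
        exact LinearMap.ext H.subtype_unitLin
      have e' : (mulLast k V.carrier Z).rTensor Z ((H.transA V).rTensor Z x) =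
          ((TensorProduct.mk k V.carrier Z).flip 1).rTensor Z x := by
        rw [← LinearMap.rTensor_comp_apply]
        congr 2
        exact LinearMap.ext H.mulLast_transA
      rw [← mulLast_rTensor, e, mulLast_mulLast, e', mulLast_rTensor_tmul_one])
    (LinearMap.ext fun x => by
      apply Submodule.rTensor_subtype_injective
      change (H.cotensor V).subtype.rTensor Z (mulLast k (H.cotensor V) Z
        ((H.unitLin V).rTensor Z (mulLast k V.carrier Z ((H.cotensor V).subtype.rTensor Z x)))) =
          (H.cotensor V).subtype.rTensor Z x
      have e : ∀ y, ((H.cotensor V).subtype.rTensor Z).rTensor Z ((H.unitLin V).rTensor Z y) =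
          (H.transA V).rTensor Z y := by
        intro y
        rw [← LinearMap.rTensor_comp_apply]
        congr 2
        exact LinearMap.ext H.subtype_unitLin
      have e' : (mulLast k (V.carrier ⊗[k] Z) Z).rTensor Z (((H.transA V).rTensor Z).rTensor Z
          ((H.cotensor V).subtype.rTensor Z x)) =
          ((TensorProduct.mk k (V.carrier ⊗[k] Z) Z).flip 1).rTensor Z
            ((H.cotensor V).subtype.rTensor Z x) := by
        simp only [← LinearMap.rTensor_comp_apply]
        congr 2
        exact LinearMap.ext H.mulLast_transA_cotensor
      rw [← mulLast_rTensor, e, ← mulLast_rTensor, mulLast_mulLast, e', mulLast_rTensor_tmul_one])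

end Descent

/-! ### The tensorator -/

section Tensor

theorem gather_mem_cotensor (t : H.cotensor V ⊗[k] H.cotensor W) :
    (gather k Z V.carrier W.carrier ∘ₗ
      TensorProduct.map (H.cotensor V).subtype (H.cotensor W).subtype) t ∈
        H.cotensor (V.tensor W) := by
  induction t with
  | zero => rw [map_zero]; exact Submodule.zero_mem _
  | add x y hx hy => rw [map_add]; exact Submodule.add_mem _ hx hy
  | tmul x y =>
    rw [mem_cotensor, LinearMap.comp_apply, TensorProduct.map_tmul, expand_gather,
      Submodule.subtype_apply, Submodule.subtype_apply, diag_rTensor_gather,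
      H.mem_cotensor.1 x.2, H.mem_cotensor.1 y.2]

/-- The multiplication map `(V □ Z) ⊗ (W □ Z) → (V ⊗ W) □ Z`. -/
noncomputable def tensorLin :
    H.cotensor V ⊗[k] H.cotensor W →ₗ[k] H.cotensor (V.tensor W) :=
  LinearMap.codRestrict _ _ (H.gather_mem_cotensor V W)

variable {V W} in
theorem subtype_tensorLin (x : H.cotensor V) (y : H.cotensor W) :
    (H.cotensor (V.tensor W)).subtype (H.tensorLin V W (x ⊗ₜ y)) =
      gather k Z V.carrier W.carrier
        ((H.cotensor V).subtype x ⊗ₜ (H.cotensor W).subtype y) := rfl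

theorem tensorLin_bijective : Function.Bijective (H.tensorLin V W) := by
  have := H.nontrivial_Z
  -- Multiply the last leg first by the `Z`-leg of `W □ Z`, then by that of `V □ Z`; `comm`
  -- identifies this with the tensorator followed by descent for V ⊗ W.
  let E : ((H.cotensor V ⊗[k] H.cotensor W) ⊗[k] Z) ≃ₗ[k] (V.carrier ⊗[k] W.carrier) ⊗[k] Z :=
    TensorProduct.assoc k _ _ _ ≪≫ₗ (H.descentEquiv W).lTensor (H.cotensor V) ≪≫ₗ
      TensorProduct.leftComm k _ _ _ ≪≫ₗ (H.descentEquiv V).lTensor W.carrier ≪≫ₗ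
      TensorProduct.leftComm k _ _ _ ≪≫ₗ (TensorProduct.assoc k _ _ _).symm
  have nat : ∀ (x : H.cotensor V) (p : W.carrier ⊗[k] Z),
      (H.descentEquiv V).lTensor W.carrier (TensorProduct.leftComm k _ _ _ (x ⊗ₜ p)) =
        (mulLast k V.carrier Z).lTensor W.carrier (TensorProduct.leftComm k _ _ _
          ((H.cotensor V).subtype x ⊗ₜ p)) := by
    intro x p
    induction p with
    | zero => simp
    | add x y hx hy => simp only [tmul_add, map_add, hx, hy]
    | tmul w z => rfl
  have comm : (H.descentEquiv (V.tensor W)).toLinearMap ∘ₗ (H.tensorLin V W).rTensor Z =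
      E.toLinearMap := by
    refine TensorProduct.ext_threefold fun x y z => ?_
    have := mulLast_gather ((H.cotensor V).subtype x) ((H.cotensor W).subtype y) z
    rw [← nat] at this
    exact this
  have bij : Function.Bijective ((H.tensorLin V W).rTensor Z) := by
    have e : (H.tensorLin V W).rTensor Z =
        (E ≪≫ₗ (H.descentEquiv (V.tensor W)).symm).toLinearMap := by
      refine LinearMap.ext fun t => ?_
      rw [LinearEquiv.coe_coe, LinearEquiv.trans_apply, LinearEquiv.eq_symm_apply]
      exact LinearMap.congr_fun comm t
    rw [e]
    exact LinearEquiv.bijective _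
  exact LinearMap.bijective_of_rTensor_bijective (V := H.cotensor V ⊗[k] H.cotensor W)
    (W := H.cotensor (V.tensor W)) bij

/-- The tensorator `(V □ Z) ⊗ (W □ Z) ≅ (V ⊗ W) □ Z`. -/
noncomputable def tensorIso :
    (H.cotensorObj V).tensor (H.cotensorObj W) ≅ H.cotensorObj (V.tensor W) :=
  Comod.mkIso (LinearEquiv.ofBijective _ (H.tensorLin_bijective V W)) <| by
    refine TensorProduct.ext' fun x y => ?_
    change H.cotensorCoact (V.tensor W) (H.tensorLin V W (x ⊗ₜ y)) =
      (H.tensorLin V W).rTensor B (gather k B (H.cotensor V) (H.cotensor W)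
        (H.cotensorCoact V x ⊗ₜ H.cotensorCoact W y))
    apply Submodule.rTensor_subtype_injective
    rw [subtype_cotensorCoact, subtype_tensorLin, expand_gather, ← subtype_cotensorCoact,
      ← subtype_cotensorCoact, gather_rTensor_tmul_rTensor, ← LinearMap.rTensor_comp_apply,
      ← LinearMap.rTensor_comp_apply]
    rfl

end Tensor

/-! ### The unit constraint -/

section Unit

/-- Unitality of `γ` gives j(1) = 1 ⊗ S(1), and m j = ε then forces S(1) = 1. -/
theorem j_one : H.j 1 = 1 ⊗ₜ 1 := by
  have h1 : H.j 1 = 1 ⊗ₜ H.S 1 := by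
    simp [j, Algebra.TensorProduct.one_def]
  have h2 := LinearMap.congr_fun H.S_γ 1
  have h3 : LinearMap.mul' k Z (H.j 1) = 1 := by
    rw [LinearMap.comp_apply, LinearMap.comp_apply, LinearMap.comp_apply, Bialgebra.counit_one,
      Algebra.linearMap_apply, RingHom.map_one] at h2
    exact h2
  rw [h1, LinearMap.mul'_apply, one_mul] at h3
  rw [h1, h3]

/-- The map `k → k □ Z`, `c ↦ c ⊗ 1`. -/
noncomputable def unitCotensorLin : k →ₗ[k] H.cotensor (Comod.unit k A) :=
  LinearMap.codRestrict _ ((TensorProduct.mk k k Z).flip 1) fun c => by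
    rw [mem_cotensor]
    simp [triv, expand_tmul, Algebra.TensorProduct.one_def]

theorem subtype_unitCotensorLin (c : k) :
    (H.cotensor (Comod.unit k A)).subtype (H.unitCotensorLin c) = c ⊗ₜ 1 := rfl

theorem unitCotensorLin_bijective : Function.Bijective H.unitCotensorLin := by
  refine ⟨fun c d h => H.tmul_one_injective (congrArg Subtype.val h), fun x => ?_⟩
  refine ⟨contract k H.φ x.1, Subtype.ext ?_⟩
  have e : ∀ c : k, H.transA (Comod.unit k A) c = (c ⊗ₜ 1) ⊗ₜ 1 := by
    intro c
    simp [transA, triv, expand_tmul, j_one]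
  have h : ∀ y : k ⊗[k] Z, mulLast k (k ⊗[k] Z) Z ((H.transA (Comod.unit k A)).rTensor Z y) =
      ((TensorProduct.mk k k Z).flip 1).rTensor Z y := by
    intro y
    induction y with
    | zero => simp
    | add x y hx hy => simp only [map_add, hx, hy]
    | tmul c z =>
      rw [LinearMap.rTensor_tmul]
      erw [e]
      simp
  -- For the trivial comodule, with x = c ⊗ z, the descent equation reads c ⊗ 1 ⊗ z = c ⊗ z ⊗ 1;
  -- applying `φ` to the last leg makes x a scalar multiple of 1 ⊗ 1.
  have h' := H.mulLast_transA_cotensor x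
  erw [h] at h'
  have h'' := congrArg (contract (k ⊗[k] Z) H.φ) h'
  rw [contract_rTensor] at h''
  erw [contract_φ_tmul_one] at h''
  exact h''

/-- The unit isomorphism `k ≅ k □ Z`. -/
noncomputable def unitCotensorIso : Comod.unit k B ≅ H.cotensorObj (Comod.unit k A) :=
  Comod.mkIso (LinearEquiv.ofBijective _ H.unitCotensorLin_bijective) <| by
    refine LinearMap.ext fun c => ?_
    change H.cotensorCoact (Comod.unit k A) (H.unitCotensorLin c) =
      H.unitCotensorLin c ⊗ₜ 1
    apply Submodule.rTensor_subtype_injective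
    rw [subtype_cotensorCoact, LinearMap.rTensor_tmul, subtype_unitCotensorLin, expand_tmul]
    simp [Algebra.TensorProduct.one_def]

end Unit

/-- The cotensor product functor is strong monoidal. -/
noncomputable def cotensorFunctorCoreMonoidal : H.cotensorFunctor.CoreMonoidal where
  εIso := H.unitCotensorIso
  μIso := H.tensorIso
  μIso_hom_natural_left {V V'} f W := Comod.hom_ext <| TensorProduct.ext' fun x y => by
    apply Submodule.injective_subtype
    change gather k Z _ _ (f.lin.rTensor Z ((H.cotensor V).subtype x) ⊗ₜ
      (H.cotensor W).subtype y) = (TensorProduct.map f.lin LinearMap.id).rTensor Z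
        (gather k Z _ _ ((H.cotensor V).subtype x ⊗ₜ (H.cotensor W).subtype y))
    rw [← gather_rTensor_tmul_rTensor, LinearMap.rTensor_id, LinearMap.id_apply]
  μIso_hom_natural_right {V V'} W f := Comod.hom_ext <| TensorProduct.ext' fun x y => by
    apply Submodule.injective_subtype
    change gather k Z _ _ ((H.cotensor W).subtype x ⊗ₜ
      f.lin.rTensor Z ((H.cotensor V).subtype y)) = (TensorProduct.map LinearMap.id f.lin).rTensor Z
        (gather k Z _ _ ((H.cotensor W).subtype x ⊗ₜ (H.cotensor V).subtype y))
    rw [← gather_rTensor_tmul_rTensor, LinearMap.rTensor_id, LinearMap.id_apply]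
  associativity _ _ _ := Comod.hom_ext <| TensorProduct.ext_threefold fun x y z => by
    apply Submodule.injective_subtype
    exact gather_assoc x.1 y.1 z.1
  left_unitality _ := Comod.hom_ext <| TensorProduct.ext' fun c x => by
    apply Submodule.injective_subtype
    exact (lid_gather c x.1).symm
  right_unitality _ := Comod.hom_ext <| TensorProduct.ext' fun x c => by
    apply Submodule.injective_subtype
    exact (rid_gather c x.1).symm

end HopfGaloisSystem

theorem corollary1p4 {k : Type u} [Field k] {A B Z T : Type u}
    [Ring A] [Bialgebra k A] [Ring B] [Bialgebra k B] [Ring Z] [Algebra k Z]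
    [Ring T] [Algebra k T] (h : HopfGaloisSystem k A B Z T) :
    MonoidallyEquivalent (Comod k A) (Comod k B) :=
  ⟨h.comodEquivalence, ⟨h.cotensorFunctorCoreMonoidal.toMonoidal⟩⟩
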